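/- Let $0<\lambda<1$. There are constants $c\ge 1$ and $c_0$, depending only on $\lambda$, such that the generalized work function algorithm $\mathrm{WFA}_\lambda$ satisfies $$\mathrm{WFA}_\lambda(\sigma)\le c\cdot \mathrm{OPT}(\sigma)+c_0$$ for every instance of the generalized 2-server problem, that is, for all metric spaces $(\mathbb X,d^{\mathbb X})$ and $(\mathbb Y,d^{\mathbb Y})$, every starting point $\mathcal O\in\mathbb X\times\mathbb Y$ and every finite request sequence $\sigma$; in other words, $\mathrm{WFA}_\lambda$ is constant competitive. Moreover, the algorithm is well defined: the minimum that defines its move always exists, and every move serves the new request. Here one server moves in $\mathbb X$ and the other one in $\mathbb Y$. A configuration is a point of $\mathbb M=\mathbb X\times\mathbb Y$, with the metric $d((x_1,y_1),(x_2,y_2))=d^{\mathbb X}(x_1,x_2)+d^{\mathbb Y}(y_1,y_2)$. A request $r$ is given by a pair $(x,y)\in\mathbb M$ and is served by the configurations whose first coordinate is $x$ or whose second coordinate is $y$. Requests arrive one by one, each has to be served before the next one arrives, and the cost is the total distance travelled by the two servers; $\mathrm{OPT}(\sigma)$ is the minimum cost of serving $\sigma$ from $\mathcal O$ when $\sigma$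 is known in advance. For a request sequence $\sigma=r_1\cdots r_n$ and $s\in\mathbb M$, the work function $W_\sigma(s)$ is the minimum of $d(\mathcal O,s_1)+d(s_1,s_2)+\dots+d(s_{n-1},s_n)+d(s_n,s)$ over all configurations $s_1,\dots,s_n$ such that $s_i$ serves $r_i$ for each $i$. If $\mathrm{WFA}_\lambda$ is in configuration $s$ after $\sigma$ and the next request is $r$, it moves to any configuration $s'$ that minimizes $W_{\sigma,r}(t)+\lambda\, d(s,t)$ over all $t\in\mathbb M$, with ties broken arbitrarily; $\mathrm{WFA}_\lambda(\sigma)$ is the total distance it travels on $\sigma$ from $\mathcal O$. -/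

import Mathlib

namespace GenTwoServer

section

variable {X Y : Type*}

/-- The request with coordinates `r = (x, y)`, as the set of configurations that serve it:
the first server is at `x` or the second server is at `y`. -/
def request (r : X × Y) : Set (X × Y) := {p | p.1 = r.1 ∨ p.2 = r.2}

/-- The path (list of configurations) `p` serves the request sequence `σ`: it has the same length
and its `i`-th configuration serves the `i`-th request. -/
def Serves (p σ : List (X × Y)) : Prop := List.Forall₂ (fun s r => s ∈ request r) p σ

variable [MetricSpace X] [MetricSpace Y]

/-- The sum metric on configurations (the Mathlib distance of `X × Y` is the max metric). -/
noncomputable def d (p q : X × Y) : ℝ := dist p.1 q.1 + dist p.2 q.2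

/-- Length of the path that starts in the given configuration and visits the list in order. -/
noncomputable def pathLength : X × Y → List (X × Y) → ℝ
  | _, [] => 0
  | o, s :: p => d o s + pathLength s p

/-- The work function: the length of a shortest path from `o` that serves `σ` and ends in `s`. -/
noncomputable def work (o : X × Y) (σ : List (X × Y)) (s : X × Y) : ℝ :=
  sInf {L | ∃ p, Serves p σ ∧ L = pathLength o (p ++ [s])}

/-- The optimal offline cost of serving `σ` from the origin `o`. -/
noncomputable def opt (o : X × Y) (σ : List (X × Y)) : ℝ :=
  sInf {L | ∃ p, Serves p σ ∧ L = pathLength o p}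

/-- `s'` is a legal move of the generalized work function algorithm with parameter `lam`, when the
servers are in `s` after `σ` and the new request is `r`: it minimizes
`W_{σ,r}(t) + lam * d s t` over all configurations `t`. -/
def IsWFAMove (lam : ℝ) (o : X × Y) (σ : List (X × Y)) (r s s' : X × Y) : Prop :=
  ∀ t : X × Y, work o (σ ++ [r]) s' + lam * d s s' ≤ work o (σ ++ [r]) t + lam * d s t

/-- A deterministic online strategy is given by its configuration `A σ` after each finite request
sequence `σ`. It is a version of the generalized work function algorithm (for some way to break
ties, possibly depending on the history) if it starts in `o` and all its moves are legal. -/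
def IsWFA (lam : ℝ) (o : X × Y) (A : List (X × Y) → X × Y) : Prop :=
  A [] = o ∧ ∀ (σ : List (X × Y)) (r : X × Y), IsWFAMove lam o σ r (A σ) (A (σ ++ [r]))

/-- The strategy starts in `o` and serves every request when it arrives. -/
def IsOnlineAlgorithm (o : X × Y) (A : List (X × Y) → X × Y) : Prop :=
  A [] = o ∧ ∀ (σ : List (X × Y)) (r : X × Y), A (σ ++ [r]) ∈ request r

/-- Total distance travelled by the two servers of the strategy `A` on the request sequence `σ`. -/
noncomputable def cost (A : List (X × Y) → X × Y) (σ : List (X × Y)) : ℝ :=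
  ∑ i ∈ Finset.range σ.length, d (A (σ.take i)) (A (σ.take (i + 1)))

end

end GenTwoServer

namespace GenTwoServer

/-! ### The sum metric, the update of a work function by a request, and the two potentials. -/

section Metric

variable {X Y : Type*}

/-! Put λ = 1 - 2η. A move from s to s' is charged `G` = W'(s') + λ d(s, s') - W(s), where W and W'
are the work functions before and after the request. These charges add up to λ times the distance
travelled plus the last work function value at the algorithm's position, so it suffices to bound
their sum by a multiple of the optimum.

The bound comes from two potentials, `pairMin` and `tripleMin`, which never decrease and are at most
a constant times W(p) for each p. After a request every value of W is inherited from a configuration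
in that request, its parent. Replacing configurations by their parents lowers pair and triple values
by at least η times the distance moved (`pairValue_add_le`, `tripleValue_add_le`), so a request that
displaces the best pair or triple raises the potentials.

Let the request change from (x, y) to (x', y'), by δx and δy, with δy ≤ δx by symmetry. If
afterwards triples gain nothing over pairs, `mul_increase_le` bounds `G`. Otherwise the rise of the
potentials pays for δy (`tripleGain_nonpos_or_le`). If it also pays for δx, then `G` ≤ 2δx suffices.
In the remaining case `G` ≤ ρ + 2δy, where ρ is the bound in `Slack.cover` for leaving the line of
configurations with first server at x. Since ρ also falls by 2ηδx, up to zero (`cover_update`), it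
pays for `G`.

What remains is that ρ grows by 2δy at each request. The gap κ of a `Slack` grows by ηδy at the same
time, so ρ - (2/η)κ does not grow. Using ρ as payment resets κ to 0, which is affordable if κ is
small; if it is not, the best triple is concentrated near (x, y) and the gain of triples over pairs
is small (`Slack.kappa_le_or_gain_le`). A second slack, with the servers exchanged, serves the
requests with δx ≤ δy. Thus `step` holds in finite spaces, and the general case restricts to a
finite grid. -/

theorem mem_request_left (r : X × Y) (b : Y) : (r.1, b) ∈ request r := Or.inl rfl

theorem mem_request_right (r : X × Y) (a : X) : (a, r.2) ∈ request r := Or.inr rfl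

variable [MetricSpace X] [MetricSpace Y]

theorem d_nonneg (p q : X × Y) : 0 ≤ d p q := add_nonneg dist_nonneg dist_nonneg

theorem d_self (p : X × Y) : d p p = 0 := by simp [d]

theorem d_comm (p q : X × Y) : d p q = d q p := by simp [d, dist_comm]

theorem d_triangle (p q t : X × Y) : d p t ≤ d p q + d q t := by
  have h₁ := dist_triangle p.1 q.1 t.1
  have h₂ := dist_triangle p.2 q.2 t.2
  unfold d
  linarith

theorem eq_of_d_le_zero {p q : X × Y} (h : d p q ≤ 0) : p = q := by
  have h₁ : 0 ≤ dist p.1 q.1 := dist_nonneg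
  have h₂ : 0 ≤ dist p.2 q.2 := dist_nonneg
  unfold d at h
  exact Prod.ext (dist_le_zero.1 (by linarith)) (dist_le_zero.1 (by linarith))

theorem d_swap (p q : X × Y) : d p.swap q.swap = d p q := by
  simp [d, add_comm]

/-- `W` is 1-Lipschitz for the sum metric. -/
def IsLip (W : X × Y → ℝ) : Prop := ∀ p q, W p ≤ W q + d p q

/-- The work function obtained from `W` by the request `r`. -/
noncomputable def update (W : X × Y → ℝ) (r p : X × Y) : ℝ :=
  min (W (r.1, p.2) + dist p.1 r.1) (W (p.1, r.2) + dist p.2 r.2)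

/-- The values of `W` are determined by those on the request `r`. -/
def Generated (W : X × Y → ℝ) (r : X × Y) : Prop := ∀ p, W p = update W r p

theorem update_of_mem {W : X × Y → ℝ} (hW : IsLip W) {r p : X × Y} (hp : p ∈ request r) :
    update W r p = W p := by
  obtain ⟨x, y⟩ := r
  obtain ⟨a, b⟩ := p
  rcases hp with h | h <;> simp only at h <;> subst h
  · have := hW (a, b) (a, y)
    simp only [d, dist_self, zero_add] at this
    simp [update, this]
  · have := hW (a, b) (x, b)
    simp only [d, dist_self, add_zero] at this
    simp [update, this]

theorem le_update {W : X × Y → ℝ} (hW : IsLip W) (r p : X × Y) : W p ≤ update W r p := by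
  have h₁ := hW p (r.1, p.2)
  have h₂ := hW p (p.1, r.2)
  simp only [d, dist_self, add_zero, zero_add] at h₁ h₂
  exact le_min h₁ h₂

theorem update_eq_add (W : X × Y → ℝ) (r p : X × Y) :
    ∃ q ∈ request r, update W r p = W q + d p q := by
  rcases min_choice (W (r.1, p.2) + dist p.1 r.1) (W (p.1, r.2) + dist p.2 r.2) with h | h
  · exact ⟨(r.1, p.2), mem_request_left _ _, by simp [update, h, d]⟩
  · exact ⟨(p.1, r.2), mem_request_right _ _, by simp [update, h, d]⟩

theorem update_le_add {W : X × Y → ℝ} (hW : IsLip W) {r q : X × Y} (hq : q ∈ request r)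
    (p : X × Y) : update W r p ≤ W q + d p q := by
  obtain ⟨x, y⟩ := r
  obtain ⟨a, b⟩ := q
  rcases hq with h | h <;> simp only at h <;> subst h
  · have := hW (a, p.2) (a, b)
    simp only [d, dist_self, zero_add] at this
    refine (min_le_left _ _).trans ?_
    simp only [d]
    linarith
  · have := hW (p.1, b) (a, b)
    simp only [d, dist_self, add_zero] at this
    refine (min_le_right _ _).trans ?_
    simp only [d]
    linarith

theorem IsLip.update {W : X × Y → ℝ} (hW : IsLip W) (r : X × Y) : IsLip (update W r) := by
  intro p q
  obtain ⟨t, ht, h⟩ := update_eq_add W r q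
  have := update_le_add hW ht p
  have := d_triangle p q t
  linarith

theorem generated_update {W : X × Y → ℝ} (hW : IsLip W) (r : X × Y) :
    Generated (update W r) r := by
  intro p
  have h₁ := update_of_mem hW (mem_request_left r p.2)
  have h₂ := update_of_mem hW (mem_request_right r p.1)
  conv_rhs => rw [update, h₁, h₂]
  rfl

theorem Generated.exists_eq_add {W : X × Y → ℝ} {r : X × Y} (h : Generated W r) (p : X × Y) :
    ∃ q ∈ request r, W p = W q + d p q := by
  rw [h p]
  exact update_eq_add W r p

theorem isLip_d (o : X × Y) : IsLip (d o) := by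
  intro p q
  have := d_triangle o q p
  rw [d_comm q p] at this
  exact this

theorem generated_d (o : X × Y) : Generated (d o) o := by
  intro p
  simp [update, d, dist_comm, add_comm]

/-! ### Potentials -/

/-- The value of a pair of configurations. -/
noncomputable def pairValue (η : ℝ) (W : X × Y → ℝ) (u v : X × Y) : ℝ :=
  W u + W v - (1 - η) * d u v

/-- The value of a triple of configurations. -/
noncomputable def tripleValue (η : ℝ) (W : X × Y → ℝ) (u v w : X × Y) : ℝ :=
  2 / η * pairValue η W u v + W w - min (W u + (1 - η) * d u w) (W v + (1 - η) * d v w)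

/-- The least value of a pair. -/
noncomputable def pairMin (η : ℝ) (W : X × Y → ℝ) : ℝ :=
  ⨅ p : (X × Y) × (X × Y), pairValue η W p.1 p.2

/-- The least value of a triple. -/
noncomputable def tripleMin (η : ℝ) (W : X × Y → ℝ) : ℝ :=
  ⨅ p : (X × Y) × (X × Y) × (X × Y), tripleValue η W p.1 p.2.1 p.2.2

/-- How far the best triple is below the best pair. -/
noncomputable def tripleGain (η : ℝ) (W : X × Y → ℝ) : ℝ :=
  2 / η * pairMin η W - tripleMin η W

/-- W falls by the full distance, while the distance term changes by at most the fraction 1 - η of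
it; η is left over. -/
theorem pairValue_add_le {η : ℝ} (hη : η < 1) {W : X × Y → ℝ} {u v u' v' : X × Y}
    (hu : W u = W u' + d u u') (hv : W v = W v' + d v v') :
    pairValue η W u' v' + η * (d u u' + d v v') ≤ pairValue η W u v := by
  have h₁ := d_triangle u u' v
  have h₂ := d_triangle u' v' v
  rw [d_comm v' v] at h₂
  have : (1 - η) * d u v ≤ (1 - η) * (d u u' + d u' v' + d v v') :=
    mul_le_mul_of_nonneg_left (by linarith) (by linarith)
  unfold pairValue
  linarith

/-- The factor 2/η turns the saving η of the pair into 2. This outweighs the 2 - η by which the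
subtracted minimum can fall, and again η is left over. -/
theorem tripleValue_add_le {η : ℝ} (hη₀ : 0 < η) (hη : η < 1) {W : X × Y → ℝ}
    {u v w u' v' w' : X × Y} (hu : W u = W u' + d u u') (hv : W v = W v' + d v v')
    (hw : W w = W w' + d w w') :
    tripleValue η W u' v' w' + η * (d u u' + d v v' + d w w') ≤ tripleValue η W u v w := by
  have h₁ := mul_le_mul_of_nonneg_left (pairValue_add_le hη hu hv)
    (by positivity : 0 ≤ 2 / η)
  have h₂ : 2 / η * (η * (d u u' + d v v')) = 2 * (d u u' + d v v') := by
    field_simp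
  rw [mul_add, h₂] at h₁
  have hd₁ := d_nonneg u u'
  have hd₂ := d_nonneg v v'
  have hd₃ := d_nonneg w w'
  have key : ∀ t t' : X × Y, W t = W t' + d t t' →
      W t + (1 - η) * d t w ≤
        W t' + (1 - η) * d t' w' + (2 - η) * d t t' + (1 - η) * d w w' := by
    intro t t' ht
    have h₁ := d_triangle t t' w
    have h₂ := d_triangle t' w' w
    rw [d_comm w' w] at h₂
    have : (1 - η) * d t w ≤ (1 - η) * (d t t' + d t' w' + d w w') :=
      mul_le_mul_of_nonneg_left (by linarith) (by linarith)
    linarith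
  have h₃ : min (W u + (1 - η) * d u w) (W v + (1 - η) * d v w) ≤
      min (W u' + (1 - η) * d u' w') (W v' + (1 - η) * d v' w') +
        (2 - η) * (d u u' + d v v') + (1 - η) * d w w' := by
    have e₁ : 0 ≤ (2 - η) * d u u' := mul_nonneg (by linarith) hd₁
    have e₂ : 0 ≤ (2 - η) * d v v' := mul_nonneg (by linarith) hd₂
    rcases min_choice (W u' + (1 - η) * d u' w') (W v' + (1 - η) * d v' w') with h | h <;> rw [h]
    · exact (min_le_left _ _).trans (by linarith [key u u' hu])
    · exact (min_le_right _ _).trans (by linarith [key v v' hv])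
  unfold tripleValue
  linarith

theorem tripleValue_congr {η : ℝ} {W W' : X × Y → ℝ} {u v w : X × Y} (hu : W u = W' u)
    (hv : W v = W' v) (hw : W w = W' w) : tripleValue η W u v w = tripleValue η W' u v w := by
  simp only [tripleValue, pairValue, hu, hv, hw]

section Finite

variable [Finite X] [Finite Y]

theorem pairMin_le (η : ℝ) (W : X × Y → ℝ) (u v : X × Y) : pairMin η W ≤ pairValue η W u v :=
  ciInf_le (f := fun p : (X × Y) × (X × Y) => pairValue η W p.1 p.2)
    (Set.finite_range _).bddBelow (u, v)

theorem tripleMin_le (η : ℝ) (W : X × Y → ℝ) (u v w : X × Y) :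
    tripleMin η W ≤ tripleValue η W u v w :=
  ciInf_le (f := fun p : (X × Y) × (X × Y) × (X × Y) => tripleValue η W p.1 p.2.1 p.2.2)
    (Set.finite_range _).bddBelow (u, v, w)

theorem exists_pairValue_eq [Nonempty X] [Nonempty Y] (η : ℝ) (W : X × Y → ℝ) :
    ∃ u v, pairValue η W u v = pairMin η W := by
  obtain ⟨p, hp⟩ := exists_eq_ciInf_of_finite
    (f := fun p : (X × Y) × (X × Y) => pairValue η W p.1 p.2)
  exact ⟨_, _, hp⟩

theorem exists_tripleValue_eq [Nonempty X] [Nonempty Y] (η : ℝ) (W : X × Y → ℝ) :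
    ∃ u v w, tripleValue η W u v w = tripleMin η W := by
  obtain ⟨p, hp⟩ := exists_eq_ciInf_of_finite
    (f := fun p : (X × Y) × (X × Y) × (X × Y) => tripleValue η W p.1 p.2.1 p.2.2)
  exact ⟨_, _, _, hp⟩

/-- Take a best pair and repeat its cheaper member as the third configuration. -/
theorem tripleGain_nonneg [Nonempty X] [Nonempty Y] {η : ℝ} (hη : η < 1) (W : X × Y → ℝ) :
    0 ≤ tripleGain η W := by
  obtain ⟨u, v, h⟩ := exists_pairValue_eq η W
  have key : ∀ w, W w ≤ min (W u + (1 - η) * d u w) (W v + (1 - η) * d v w) →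
      0 ≤ tripleGain η W := by
    intro w hw
    have := tripleMin_le η W u v w
    rw [tripleValue, h] at this
    unfold tripleGain
    linarith
  have h₁ : 0 ≤ (1 - η) * d u v := mul_nonneg (by linarith) (d_nonneg _ _)
  rcases le_total (W u) (W v) with h | h
  · refine key u (le_min (by simp [d_self]) ?_)
    rw [d_comm]
    linarith
  · exact key v (le_min (by linarith) (by simp [d_self]))

/-- A pair in the new request that attains the least value after the request. -/
theorem exists_pair_update [Nonempty X] [Nonempty Y] {η : ℝ} (hη₀ : 0 < η) (hη : η < 1)
    {W : X × Y → ℝ} (hW : IsLip W) (r : X × Y) :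
    ∃ u ∈ request r, ∃ v ∈ request r, pairValue η W u v ≤ pairMin η (update W r) := by
  obtain ⟨u, v, h⟩ := exists_pairValue_eq η (update W r)
  obtain ⟨u', hu', hu⟩ := (generated_update hW r).exists_eq_add u
  obtain ⟨v', hv', hv⟩ := (generated_update hW r).exists_eq_add v
  refine ⟨u', hu', v', hv', ?_⟩
  have := pairValue_add_le hη hu hv
  have : 0 ≤ η * (d u u' + d v v') :=
    mul_nonneg hη₀.le (add_nonneg (d_nonneg _ _) (d_nonneg _ _))
  have e : pairValue η W u' v' = pairValue η (update W r) u' v' := by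
    simp only [pairValue, update_of_mem hW hu', update_of_mem hW hv']
  linarith

/-- A triple in the new request that attains the least value after the request. -/
theorem exists_triple_update [Nonempty X] [Nonempty Y] {η : ℝ} (hη₀ : 0 < η) (hη : η < 1)
    {W : X × Y → ℝ} (hW : IsLip W) (r : X × Y) :
    ∃ u ∈ request r, ∃ v ∈ request r, ∃ w ∈ request r,
      tripleValue η W u v w ≤ tripleMin η (update W r) := by
  obtain ⟨u, v, w, h⟩ := exists_tripleValue_eq η (update W r)
  obtain ⟨u', hu', hu⟩ := (generated_update hW r).exists_eq_add u
  obtain ⟨v', hv', hv⟩ := (generated_update hW r).exists_eq_add v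
  obtain ⟨w', hw', hw⟩ := (generated_update hW r).exists_eq_add w
  refine ⟨u', hu', v', hv', w', hw', ?_⟩
  have := tripleValue_add_le hη₀ hη hu hv hw
  have : 0 ≤ η * (d u u' + d v v' + d w w') :=
    mul_nonneg hη₀.le (add_nonneg (add_nonneg (d_nonneg _ _) (d_nonneg _ _)) (d_nonneg _ _))
  have e : tripleValue η W u' v' w' = tripleValue η (update W r) u' v' w' :=
    tripleValue_congr (update_of_mem hW hu').symm (update_of_mem hW hv').symm
      (update_of_mem hW hw').symm
  linarith

theorem pairMin_le_update [Nonempty X] [Nonempty Y] {η : ℝ} (hη₀ : 0 < η) (hη : η < 1)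
    {W : X × Y → ℝ} (hW : IsLip W) (r : X × Y) : pairMin η W ≤ pairMin η (update W r) := by
  obtain ⟨u, -, v, -, h⟩ := exists_pair_update hη₀ hη hW r
  exact (pairMin_le η W u v).trans h

theorem tripleMin_le_update [Nonempty X] [Nonempty Y] {η : ℝ} (hη₀ : 0 < η) (hη : η < 1)
    {W : X × Y → ℝ} (hW : IsLip W) (r : X × Y) : tripleMin η W ≤ tripleMin η (update W r) := by
  obtain ⟨u, -, v, -, w, -, h⟩ := exists_triple_update hη₀ hη hW r
  exact (tripleMin_le η W u v w).trans h

end Finite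

/-! ### Exchanging the two servers -/

theorem pairValue_swap (η : ℝ) (W : X × Y → ℝ) (u v : X × Y) :
    pairValue η (W ∘ Prod.swap) u.swap v.swap = pairValue η W u v := by
  simp [pairValue, d_swap]

theorem tripleValue_swap (η : ℝ) (W : X × Y → ℝ) (u v w : X × Y) :
    tripleValue η (W ∘ Prod.swap) u.swap v.swap w.swap = tripleValue η W u v w := by
  simp [tripleValue, pairValue_swap, d_swap]

theorem pairMin_swap (η : ℝ) (W : X × Y → ℝ) : pairMin η (W ∘ Prod.swap) = pairMin η W :=
  (Equiv.iInf_congr ((Equiv.prodComm X Y).prodCongr (Equiv.prodComm X Y))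
    fun p => pairValue_swap η W p.1 p.2).symm

theorem tripleMin_swap (η : ℝ) (W : X × Y → ℝ) : tripleMin η (W ∘ Prod.swap) = tripleMin η W :=
  (Equiv.iInf_congr ((Equiv.prodComm X Y).prodCongr
      ((Equiv.prodComm X Y).prodCongr (Equiv.prodComm X Y)))
    fun p => tripleValue_swap η W p.1 p.2.1 p.2.2).symm

theorem tripleGain_swap (η : ℝ) (W : X × Y → ℝ) : tripleGain η (W ∘ Prod.swap) = tripleGain η W := by
  simp only [tripleGain, pairMin_swap, tripleMin_swap]

theorem update_swap (W : X × Y → ℝ) (r : X × Y) :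
    update (W ∘ Prod.swap) r.swap = update W r ∘ Prod.swap := by
  funext p
  simp [update, min_comm]

theorem IsLip.swap {W : X × Y → ℝ} (hW : IsLip W) : IsLip (W ∘ Prod.swap) := by
  intro p q
  have := hW p.swap q.swap
  rwa [d_swap] at this

theorem Generated.swap {W : X × Y → ℝ} {r : X × Y} (h : Generated W r) :
    Generated (W ∘ Prod.swap) r.swap := by
  intro p
  rw [update_swap]
  exact h p.swap

end Metric

end GenTwoServer

namespace GenTwoServer

/-! ### How slacks, pairs and triples react to one request. -/

section Step

variable {X Y : Type*} [MetricSpace X] [MetricSpace Y]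

/-- The weight of the error term in `slackCost`. -/
noncomputable def slackWeight (η : ℝ) : ℝ := (2 / η + 2) * (9 / η)

/-- `ρ` bounds how much a configuration with the first server at `r.1` can be preferable to those
with the second server at `r.2`; and, up to the error `θ`, a triple in the request that contains
`(a, r.2)` exceeds the least value by `κ` or in proportion to the distance of `a` to `r.1`. -/
structure Slack (η : ℝ) (W : X × Y → ℝ) (r : X × Y) (ρ κ θ : ℝ) : Prop where
  rho_nonneg : 0 ≤ ρ
  kappa_nonneg : 0 ≤ κ
  theta_nonneg : 0 ≤ θ
  cover : ∀ b, ∃ a, W (a, r.2) + (1 - 2 * η) * (dist a r.1 + dist b r.2) ≤ W (r.1, b) + ρ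
  gap : ∀ u ∈ request r, ∀ v ∈ request r, ∀ w ∈ request r, ∀ a,
    (u = (a, r.2) ∨ v = (a, r.2) ∨ w = (a, r.2)) →
      tripleMin η W + min κ (η * dist a r.1) - θ ≤ tripleValue η W u v w

/-- The contribution of a slack to the potential. -/
noncomputable def slackCost (η : ℝ) (W : X × Y → ℝ) (ρ κ θ : ℝ) : ℝ :=
  min (2 / η * tripleGain η W) (max (ρ - 2 / η * κ) 0) + slackWeight η * θ

theorem slackWeight_nonneg {η : ℝ} (hη₀ : 0 < η) : 0 ≤ slackWeight η := by
  unfold slackWeight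
  positivity

/-- Going back to the parent moves one server. If it is the one that serves `r'`, it travels exactly
the coordinate change of the request; if it is the other one, `r'` stays served. -/
theorem exists_parent {W : X × Y → ℝ} {r : X × Y} (hr : Generated W r) {r' t : X × Y}
    (ht : t ∈ request r') :
    ∃ p ∈ request r, W t = W p + d t p ∧
      (p ∈ request r' ∨ (p = (r.1, t.2) ∧ d t p = dist r'.1 r.1) ∨
        (p = (t.1, r.2) ∧ d t p = dist r'.2 r.2)) := by
  have h := hr t
  rcases min_choice (W (r.1, t.2) + dist t.1 r.1) (W (t.1, r.2) + dist t.2 r.2) with e | e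
  · refine ⟨(r.1, t.2), mem_request_left _ _, by rw [h, update, e]; simp [d], ?_⟩
    rcases ht with ht | ht
    · exact Or.inr (Or.inl ⟨rfl, by simp [d, ht]⟩)
    · exact Or.inl (Or.inr ht)
  · refine ⟨(t.1, r.2), mem_request_right _ _, by rw [h, update, e]; simp [d], ?_⟩
    rcases ht with ht | ht
    · exact Or.inl (Or.inl ht)
    · exact Or.inr (Or.inr ⟨rfl, by simp [d, ht]⟩)

/-- If (x', b) inherits its value from (x, b), that value contains the full δx, of which the
triangle inequality needs only the fraction 1 - 2η. If it inherits from (x', y), then a = x' works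
with error 2δy. -/
theorem cover_update {η : ℝ} (hη₀ : 0 < η) (hη : η < 1 / 2) {W : X × Y → ℝ} (hW : IsLip W)
    {r : X × Y} (hr : Generated W r) (r' : X × Y) {ρ : ℝ}
    (h : ∀ b, ∃ a, W (a, r.2) + (1 - 2 * η) * (dist a r.1 + dist b r.2) ≤ W (r.1, b) + ρ) (b : Y) :
    ∃ a, update W r' (a, r'.2) + (1 - 2 * η) * (dist a r'.1 + dist b r'.2) ≤
      update W r' (r'.1, b) + (max (ρ - 2 * η * dist r'.1 r.1) 0 + 2 * dist r'.2 r.2) := by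
  have hy : ∀ a, W (a, r'.2) ≤ W (a, r.2) + dist r'.2 r.2 := by
    intro a
    have := hW (a, r'.2) (a, r.2)
    simpa [d] using this
  have hb : dist b r'.2 ≤ dist b r.2 + dist r'.2 r.2 := by
    have := dist_triangle b r.2 r'.2
    rwa [dist_comm r.2 r'.2] at this
  have hδ : 0 ≤ η * dist r'.2 r.2 := mul_nonneg hη₀.le dist_nonneg
  have hx := hr (r'.1, b)
  rcases min_choice (W (r.1, b) + dist r'.1 r.1) (W (r'.1, r.2) + dist b r.2) with e | e
  · rw [update, e] at hx
    obtain ⟨a, ha⟩ := h b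
    refine ⟨a, ?_⟩
    rw [update_of_mem hW (mem_request_left _ _), update_of_mem hW (mem_request_right _ _), hx]
    have hxa : dist a r'.1 ≤ dist a r.1 + dist r'.1 r.1 := by
      have := dist_triangle a r.1 r'.1
      rwa [dist_comm r.1 r'.1] at this
    have := mul_le_mul_of_nonneg_left (add_le_add hxa hb) (by linarith : 0 ≤ 1 - 2 * η)
    have := le_max_left (ρ - 2 * η * dist r'.1 r.1) 0
    have := hy a
    linarith
  · rw [update, e] at hx
    refine ⟨r'.1, ?_⟩
    rw [update_of_mem hW (mem_request_left r' b), update_of_mem hW (mem_request_right _ _), hx,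
      dist_self, zero_add]
    have := mul_le_mul_of_nonneg_left hb (by linarith : 0 ≤ 1 - 2 * η)
    have := le_max_right (ρ - 2 * η * dist r'.1 r.1) 0
    have := hy r'.1
    have : 0 ≤ η * dist b r.2 := mul_nonneg hη₀.le dist_nonneg
    linarith

/-- A cheap pair stays away from every configuration in which the algorithm can be, up to the
gain of triples over pairs. -/
theorem mul_min_d_le [Finite X] [Finite Y] {η : ℝ} (hη₀ : 0 < η) {W : X × Y → ℝ} {s u v : X × Y}
    {P : ℝ} (hs : ∀ t, W s ≤ W t + (1 - 2 * η) * d s t) (h : pairValue η W u v ≤ P) :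
    η * min (d u s) (d v s) ≤ 2 / η * P - tripleMin η W := by
  -- With `s` as third configuration the triple has value at most (2/η)P - η min(d u s, d v s).
  have h₁ := tripleMin_le η W u v s
  have h₂ := mul_le_mul_of_nonneg_left h (by positivity : 0 ≤ 2 / η)
  have h₃ : W s + η * min (d u s) (d v s) ≤
      min (W u + (1 - η) * d u s) (W v + (1 - η) * d v s) := by
    have a₁ := mul_le_mul_of_nonneg_left (min_le_left (d u s) (d v s)) hη₀.le
    have a₂ := mul_le_mul_of_nonneg_left (min_le_right (d u s) (d v s)) hη₀.le
    have b₁ := hs u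
    have b₂ := hs v
    rw [d_comm] at b₁ b₂
    exact le_min (by linarith) (by linarith)
  unfold tripleValue at h₁
  linarith

/-- The increase of the work function at the position of the algorithm. -/
theorem mul_increase_le [Finite X] [Finite Y] [Nonempty X] [Nonempty Y] {η : ℝ} (hη₀ : 0 < η)
    (hη : η < 1 / 2) {W : X × Y → ℝ} (hW : IsLip W) (r' : X × Y) {s : X × Y} {G : ℝ}
    (hs : ∀ t, W s ≤ W t + (1 - 2 * η) * d s t) (hG : G ≤ update W r' s - W s) :
    η * G ≤ 2 * (2 / η * pairMin η (update W r') - tripleMin η W) := by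
  obtain ⟨u, hu, v, hv, h⟩ := exists_pair_update hη₀ (by linarith) hW r'
  have h₁ := mul_min_d_le hη₀ hs h
  -- The new value at `s` is at most W(t) + d(s, t) ≤ W(s) + 2 d(s, t).
  have key : ∀ t ∈ request r', G / 2 ≤ d t s := by
    intro t ht
    have := update_le_add hW ht s
    have := hW t s
    rw [d_comm s t] at *
    linarith
  have := mul_le_mul_of_nonneg_left (le_min (key u hu) (key v hv)) hη₀.le
  linarith

theorem parent_on_line {r r' t p : X × Y} (hp : p ∈ request r)
    (h : p ∈ request r' ∨ (p = (r.1, t.2) ∧ d t p = dist r'.1 r.1) ∨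
        (p = (t.1, r.2) ∧ d t p = dist r'.2 r.2)) (hlt : d t p < dist r'.1 r.1) :
    p = (p.1, r.2) ∨ p = (r.1, r'.2) := by
  rcases h with h | h | h
  · rcases hp with hp | hp
    · rcases h with h | h
      · rw [← hp, h, dist_self] at hlt
        exact absurd (d_nonneg t p) (by linarith)
      · exact Or.inr (Prod.ext hp h)
    · exact Or.inl (Prod.ext rfl hp)
  · exact absurd h.2 hlt.ne
  · exact Or.inl (by rw [h.1])

/-- A pair close to the old line of the second server whose value is at most the least value
after the request, unless the least value of pairs increases. -/
theorem exists_pair_near_line [Finite X] [Finite Y] [Nonempty X] [Nonempty Y] {η : ℝ}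
    (hη₀ : 0 < η) (hη : η < 1 / 2) {W : X × Y → ℝ} (hW : IsLip W) {r : X × Y}
    (hr : Generated W r) (r' : X × Y)
    (hlt : pairMin η (update W r') - pairMin η W < η * dist r'.1 r.1) :
    ∃ u v, pairValue η W u v ≤ pairMin η (update W r') ∧ dist u.2 r.2 ≤ dist r'.2 r.2 ∧
      dist v.2 r.2 ≤ dist r'.2 r.2 := by
  obtain ⟨u, hu, v, hv, h⟩ := exists_pair_update hη₀ (by linarith) hW r'
  obtain ⟨u', hu₀, hu₁, hu₂⟩ := exists_parent hr hu
  obtain ⟨v', hv₀, hv₁, hv₂⟩ := exists_parent hr hv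
  have hp := pairValue_add_le (η := η) (by linarith) hu₁ hv₁
  have h₀ := pairMin_le η W u' v'
  have du := mul_nonneg hη₀.le (d_nonneg u u')
  have dv := mul_nonneg hη₀.le (d_nonneg v v')
  have key : ∀ p : X × Y, p = (p.1, r.2) ∨ p = (r.1, r'.2) → dist p.2 r.2 ≤ dist r'.2 r.2 := by
    rintro p (h | h) <;> rw [h]
    simp
  exact ⟨u', v', by linarith,
    key _ (parent_on_line hu₀ hu₂ (lt_of_mul_lt_mul_left (by linarith) hη₀.le)),
    key _ (parent_on_line hv₀ hv₂ (lt_of_mul_lt_mul_left (by linarith) hη₀.le))⟩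

/-- If pairs do not get more expensive, then the cover property of a slack holds with a bound in
terms of the gain of triples over pairs. -/
theorem cover_of_gain [Finite X] [Finite Y] [Nonempty X] [Nonempty Y] {η : ℝ}
    (hη₀ : 0 < η) (hη : η < 1 / 2) {W : X × Y → ℝ} (hW : IsLip W) {r : X × Y}
    (hr : Generated W r) (r' : X × Y)
    (hlt : pairMin η (update W r') - pairMin η W < η * dist r'.1 r.1) (b : Y) :
    ∃ a, W (a, r.2) + (1 - 2 * η) * (dist a r.1 + dist b r.2) ≤ W (r.1, b) +
      max (2 / η * (2 / η * pairMin η (update W r') - tripleMin η W) + 2 * dist r'.2 r.2) 0 := by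
  -- The best a and the worst b: their defect is the least admissible ρ. If it is positive, (x, b₀)
  -- satisfies the inequality of an algorithm position (`hs`), so `mul_min_d_le` applies there,
  -- while configurations near the line of y are at distance at least ρ/2 - δy from it.
  obtain ⟨a₀, ha₀⟩ := Finite.exists_min fun a => W (a, r.2) + (1 - 2 * η) * dist a r.1
  obtain ⟨b₀, hb₀⟩ := Finite.exists_max fun b => (1 - 2 * η) * dist b r.2 - W (r.1, b)
  refine ⟨a₀, ?_⟩
  have hb := hb₀ b
  set ρ := W (a₀, r.2) + (1 - 2 * η) * (dist a₀ r.1 + dist b₀ r.2) - W (r.1, b₀) with hρ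
  suffices h : ρ ≤
      max (2 / η * (2 / η * pairMin η (update W r') - tripleMin η W) + 2 * dist r'.2 r.2) 0 by
    linarith
  rcases le_or_gt ρ 0 with h0 | h0
  · exact h0.trans (le_max_right _ _)
  refine le_trans ?_ (le_max_left _ _)
  have hl : 0 < 1 - 2 * η := by linarith
  have hs : ∀ t, W (r.1, b₀) ≤ W t + (1 - 2 * η) * d (r.1, b₀) t := by
    intro t
    obtain ⟨p, hp, e⟩ := hr.exists_eq_add t
    have hp' : W (r.1, b₀) ≤ W p + (1 - 2 * η) * d (r.1, b₀) p := by
      obtain ⟨a, b⟩ := p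
      rcases hp with hp | hp <;> simp only at hp <;> subst hp
      · have h₁ := hb₀ b
        have h₂ := mul_le_mul_of_nonneg_left (dist_triangle b b₀ r.2) hl.le
        have h₃ := mul_le_mul_of_nonneg_left (dist_triangle b₀ b r.2) hl.le
        simp only [d, dist_self]
        linarith
      · have h₁ := ha₀ a
        simp only [d, dist_comm r.1 a]
        linarith
    have h₁ := mul_le_mul_of_nonneg_left (d_triangle (r.1, b₀) t p) hl.le
    have h₂ := mul_nonneg hη₀.le (d_nonneg t p)
    linarith
  obtain ⟨u, v, h, hu, hv⟩ := exists_pair_near_line hη₀ hη hW hr r' hlt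
  have key : ∀ t : X × Y, dist t.2 r.2 ≤ dist r'.2 r.2 →
      ρ / 2 - dist r'.2 r.2 ≤ d t (r.1, b₀) := by
    intro t ht
    have h₁ := ha₀ t.1
    have h₂ := hW (t.1, r.2) (r.1, b₀)
    have h₃ := dist_triangle b₀ t.2 r.2
    simp only [d] at h₂ ⊢
    rw [dist_comm r.2 b₀] at h₂
    rw [dist_comm t.2 b₀]
    have : 0 ≤ η * (dist t.1 r.1 + dist b₀ r.2) :=
      mul_nonneg hη₀.le (add_nonneg dist_nonneg dist_nonneg)
    linarith
  have h₁ := mul_min_d_le hη₀ hs h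
  have h₂ := mul_le_mul_of_nonneg_left (le_min (key u hu) (key v hv)) hη₀.le
  have h₃ := mul_le_mul_of_nonneg_left (h₂.trans h₁) (by positivity : 0 ≤ 2 / η)
  have h₄ : 2 / η * (η * (ρ / 2 - dist r'.2 r.2)) = ρ - 2 * dist r'.2 r.2 := by
    field_simp
  linarith

/-- With κ = θ = 0 the gap condition is void, so any cover bound yields a slack. -/
theorem Slack.reset [Finite X] [Finite Y] {η : ℝ} (hη₀ : 0 < η) (hη : η < 1 / 2)
    {W : X × Y → ℝ} (hW : IsLip W) {r : X × Y} (hr : Generated W r) (r' : X × Y) {ρ : ℝ}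
    (h : ∀ b, ∃ a, W (a, r.2) + (1 - 2 * η) * (dist a r.1 + dist b r.2) ≤ W (r.1, b) + ρ) :
    Slack η (update W r') r' (max (ρ - 2 * η * dist r'.1 r.1) 0 + 2 * dist r'.2 r.2) 0 0 where
  rho_nonneg := add_nonneg (le_max_right _ _) (mul_nonneg zero_le_two dist_nonneg)
  kappa_nonneg := le_rfl
  theta_nonneg := le_rfl
  cover := cover_update hη₀ hη hW hr r' h
  gap u _ v _ w _ a _ := by
    have := tripleMin_le η (update W r') u v w
    have := min_le_left 0 (η * dist a r'.1)
    linarith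

/-- The parent of (a, y') is either (a, y), at distance δy, which raises κ, or (x, y'), at distance
`dist a x`, which gives the other term of the minimum outright. The error θ absorbs the rise of
`tripleMin` and the shift of the centre from x to x'. -/
theorem Slack.update [Finite X] [Finite Y] [Nonempty X] [Nonempty Y] {η : ℝ} (hη₀ : 0 < η)
    (hη : η < 1 / 2) {W : X × Y → ℝ} (hW : IsLip W) {r : X × Y} (hr : Generated W r) (r' : X × Y)
    {ρ κ θ : ℝ} (h : Slack η W r ρ κ θ) :
    Slack η (update W r') r' (max (ρ - 2 * η * dist r'.1 r.1) 0 + 2 * dist r'.2 r.2)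
      (κ + η * dist r'.2 r.2)
      (θ + (tripleMin η (GenTwoServer.update W r') - tripleMin η W) + η * dist r'.1 r.1) where
  rho_nonneg := add_nonneg (le_max_right _ _) (mul_nonneg zero_le_two dist_nonneg)
  kappa_nonneg := add_nonneg h.kappa_nonneg (mul_nonneg hη₀.le dist_nonneg)
  theta_nonneg := add_nonneg (add_nonneg h.theta_nonneg
    (sub_nonneg.2 (tripleMin_le_update hη₀ (by linarith) hW r'))) (mul_nonneg hη₀.le dist_nonneg)
  cover := cover_update hη₀ hη hW hr r' h.cover
  gap u hu v hv w hw a ha := by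
    rw [tripleValue_congr (update_of_mem hW hu) (update_of_mem hW hv) (update_of_mem hW hw)]
    have parent : ∀ t ∈ request r', ∃ p ∈ request r, W t = W p + d t p ∧ (t = (a, r'.2) →
        (p = (a, r.2) ∧ d t p = dist r'.2 r.2) ∨ d t p = dist a r.1) := by
      intro t ht
      by_cases e : t = (a, r'.2)
      · subst e
        have := hr (a, r'.2)
        rcases min_choice (W (r.1, r'.2) + dist a r.1) (W (a, r.2) + dist r'.2 r.2) with e | e
        · exact ⟨(r.1, r'.2), mem_request_left _ _, by rw [this, GenTwoServer.update, e]; simp [d],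
            fun _ => Or.inr (by simp [d])⟩
        · exact ⟨(a, r.2), mem_request_right _ _, by rw [this, GenTwoServer.update, e]; simp [d],
            fun _ => Or.inl ⟨rfl, by simp [d]⟩⟩
      · obtain ⟨p, hp, h₁, -⟩ := exists_parent hr ht
        exact ⟨p, hp, h₁, fun h => absurd h e⟩
    obtain ⟨u', hu₀, hu₁, hu₂⟩ := parent u hu
    obtain ⟨v', hv₀, hv₁, hv₂⟩ := parent v hv
    obtain ⟨w', hw₀, hw₁, hw₂⟩ := parent w hw
    have hJ := tripleValue_add_le hη₀ (by linarith) hu₁ hv₁ hw₁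
    have du := mul_nonneg hη₀.le (d_nonneg u u')
    have dv := mul_nonneg hη₀.le (d_nonneg v v')
    have dw := mul_nonneg hη₀.le (d_nonneg w w')
    have tri : η * dist a r'.1 ≤ η * (dist a r.1 + dist r'.1 r.1) := by
      refine mul_le_mul_of_nonneg_left ?_ hη₀.le
      have := dist_triangle a r.1 r'.1
      rwa [dist_comm r.1 r'.1] at this
    have hθ := h.theta_nonneg
    have near : η * dist a r.1 ≤ η * (d u u' + d v v' + d w w') →
        tripleMin η (GenTwoServer.update W r') + min (κ + η * dist r'.2 r.2) (η * dist a r'.1) -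
          (θ + (tripleMin η (GenTwoServer.update W r') - tripleMin η W) + η * dist r'.1 r.1) ≤
            tripleValue η W u v w := by
      intro hn
      have := min_le_right (κ + η * dist r'.2 r.2) (η * dist a r'.1)
      have := tripleMin_le η W u' v' w'
      linarith
    have far : (u' = (a, r.2) ∨ v' = (a, r.2) ∨ w' = (a, r.2)) →
        η * dist r'.2 r.2 ≤ η * (d u u' + d v v' + d w w') →
        tripleMin η (GenTwoServer.update W r') + min (κ + η * dist r'.2 r.2) (η * dist a r'.1) -
          (θ + (tripleMin η (GenTwoServer.update W r') - tripleMin η W) + η * dist r'.1 r.1) ≤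
            tripleValue η W u v w := by
      intro hp hn
      have h₁ := h.gap u' hu₀ v' hv₀ w' hw₀ a hp
      have h₂ : 0 ≤ η * dist r'.2 r.2 := mul_nonneg hη₀.le dist_nonneg
      have h₃ : 0 ≤ η * dist r'.1 r.1 := mul_nonneg hη₀.le dist_nonneg
      have : min (κ + η * dist r'.2 r.2) (η * dist a r'.1) ≤
          min κ (η * dist a r.1) + η * dist r'.2 r.2 + η * dist r'.1 r.1 := by
        rcases min_choice κ (η * dist a r.1) with e | e <;> rw [e]
        · exact (min_le_left _ _).trans (by linarith)
        · exact (min_le_right _ _).trans (by linarith)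
      linarith
    rcases ha with ha | ha | ha
    · rcases hu₂ ha with ⟨e, e'⟩ | e'
      · exact far (Or.inl e) (by rw [← e']; linarith)
      · exact near (by rw [← e']; linarith)
    · rcases hv₂ ha with ⟨e, e'⟩ | e'
      · exact far (Or.inr (Or.inl e)) (by rw [← e']; linarith)
      · exact near (by rw [← e']; linarith)
    · rcases hw₂ ha with ⟨e, e'⟩ | e'
      · exact far (Or.inr (Or.inr e)) (by rw [← e']; linarith)
      · exact near (by rw [← e']; linarith)

/-- Triples in a set of two configurations are not better than pairs. -/
theorem pairMin_le_tripleValue [Finite X] [Finite Y] {η : ℝ} (hη₀ : 0 < η) (hη : η < 1 / 2)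
    (W : X × Y → ℝ) {u v w p q : X × Y} (hu : u = p ∨ u = q) (hv : v = p ∨ v = q)
    (hw : w = p ∨ w = q) : 2 / η * pairMin η W ≤ tripleValue η W u v w := by
  have hC : 1 ≤ 2 / η := by rw [le_div_iff₀ hη₀]; linarith
  have h₁ := mul_le_mul_of_nonneg_left (pairMin_le η W u v) (by linarith : 0 ≤ 2 / η)
  have hmin₁ := min_le_left (W u + (1 - η) * d u w) (W v + (1 - η) * d v w)
  have hmin₂ := min_le_right (W u + (1 - η) * d u w) (W v + (1 - η) * d v w)
  unfold tripleValue
  by_cases e₁ : w = u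
  · subst e₁
    rw [d_self] at hmin₁ ⊢
    linarith
  by_cases e₂ : w = v
  · subst e₂
    rw [d_self] at hmin₂ ⊢
    linarith
  have e₃ : u = v := by
    rcases hu with rfl | rfl <;> rcases hv with rfl | rfl <;> rcases hw with rfl | rfl <;>
      first | rfl | exact absurd rfl e₁ | exact absurd rfl e₂
  subst e₃
  -- For u = v the triple value is at least (2/η - 1) `pairValue u u` + `pairValue u w`.
  have h₂ := pairMin_le η W u w
  have h₃ := mul_le_mul_of_nonneg_left (pairMin_le η W u u) (by linarith : 0 ≤ 2 / η - 1)
  unfold pairValue at *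
  rw [d_self] at *
  linarith

/-- If `tripleMin` rises by less than ηδy ≤ ηδx, no parent of the best triple lies across a
coordinate change. So all three parents serve both requests, and only two configurations do. -/
theorem tripleGain_nonpos_or_le [Finite X] [Finite Y] [Nonempty X] [Nonempty Y] {η : ℝ}
    (hη₀ : 0 < η) (hη : η < 1 / 2) {W : X × Y → ℝ} (hW : IsLip W) {r : X × Y}
    (hr : Generated W r) (r' : X × Y) (hle : dist r'.2 r.2 ≤ dist r'.1 r.1) :
    tripleGain η (update W r') ≤ 0 ∨
      η * dist r'.2 r.2 ≤ tripleMin η (update W r') - tripleMin η W := by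
  obtain ⟨u, hu, v, hv, w, hw, h⟩ := exists_triple_update hη₀ (by linarith) hW r'
  obtain ⟨u', hu₀, hu₁, hu₂⟩ := exists_parent hr hu
  obtain ⟨v', hv₀, hv₁, hv₂⟩ := exists_parent hr hv
  obtain ⟨w', hw₀, hw₁, hw₂⟩ := exists_parent hr hw
  have hJ := tripleValue_add_le hη₀ (by linarith) hu₁ hv₁ hw₁
  have du := mul_nonneg hη₀.le (d_nonneg u u')
  have dv := mul_nonneg hη₀.le (d_nonneg v v')
  have dw := mul_nonneg hη₀.le (d_nonneg w w')
  have h₀ := tripleMin_le η W u' v' w'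
  rcases lt_or_ge (tripleMin η (update W r') - tripleMin η W) (η * dist r'.2 r.2) with hlt | hge
  · left
    have key : ∀ t p : X × Y, (p ∈ request r' ∨ (p = (r.1, t.2) ∧ d t p = dist r'.1 r.1) ∨
        (p = (t.1, r.2) ∧ d t p = dist r'.2 r.2)) → η * d t p < η * dist r'.2 r.2 →
        p ∈ request r' := by
      intro t p h hlt
      have := lt_of_mul_lt_mul_left hlt hη₀.le
      rcases h with h | h | h
      · exact h
      · linarith [h.2]
      · linarith [h.2]
    have hne₂ : r'.2 ≠ r.2 := by
      intro e
      rw [e, dist_self, mul_zero] at hlt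
      linarith
    have hne₁ : r'.1 ≠ r.1 := by
      intro e
      rw [e, dist_self] at hle
      exact hne₂ (dist_le_zero.1 hle)
    have two : ∀ p ∈ request r, p ∈ request r' → p = (r'.1, r.2) ∨ p = (r.1, r'.2) := by
      intro p h h'
      rcases h with h | h <;> rcases h' with h' | h'
      · exact absurd (h'.symm.trans h) hne₁
      · exact Or.inr (Prod.ext h h')
      · exact Or.inl (Prod.ext h' h)
      · exact absurd (h'.symm.trans h) hne₂
    have hu' := key u u' hu₂ (by linarith)
    have hv' := key v v' hv₂ (by linarith)
    have hw' := key w w' hw₂ (by linarith)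
    have := pairMin_le_tripleValue hη₀ hη (update W r') (two _ hu₀ hu') (two _ hv₀ hv')
      (two _ hw₀ hw')
    rw [tripleValue_congr (update_of_mem hW hu') (update_of_mem hW hv') (update_of_mem hW hw')]
      at this
    unfold tripleGain
    linarith
  · exact Or.inr hge

/-- If neither coordinate change of the request is charged to the triples, then either `κ` or the
gain of triples over pairs is small. -/
theorem Slack.kappa_le_or_gain_le [Finite X] [Finite Y] [Nonempty X] [Nonempty Y] {η : ℝ}
    (hη₀ : 0 < η) (hη : η < 1 / 2) {W : X × Y → ℝ} (hW : IsLip W) {r : X × Y}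
    (hr : Generated W r) (r' : X × Y) {ρ κ θ ε : ℝ} (h : Slack η W r ρ κ θ)
    (hε : tripleMin η (GenTwoServer.update W r') - tripleMin η W = ε)
    (hy : η * dist r'.2 r.2 ≤ ε) (hx : ε < η * dist r'.1 r.1) :
    κ ≤ ε + θ ∨ tripleGain η W ≤ 9 / η * (ε + θ) := by
  obtain ⟨u, hu, v, hv, w, hw, hm⟩ := exists_triple_update hη₀ (by linarith) hW r'
  obtain ⟨u', hu₀, hu₁, hu₂⟩ := exists_parent hr hu
  obtain ⟨v', hv₀, hv₁, hv₂⟩ := exists_parent hr hv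
  obtain ⟨w', hw₀, hw₁, hw₂⟩ := exists_parent hr hw
  have hJ := tripleValue_add_le hη₀ (by linarith) hu₁ hv₁ hw₁
  have du := mul_nonneg hη₀.le (d_nonneg u u')
  have dv := mul_nonneg hη₀.le (d_nonneg v v')
  have dw := mul_nonneg hη₀.le (d_nonneg w w')
  have h₀ := tripleMin_le η W u' v' w'
  have hu₃ := parent_on_line hu₀ hu₂ (lt_of_mul_lt_mul_left (by linarith) hη₀.le)
  have hw₃ := parent_on_line hw₀ hw₂ (lt_of_mul_lt_mul_left (by linarith) hη₀.le)
  have hθ := h.theta_nonneg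
  rcases le_or_gt κ (ε + θ) with hκ | hκ
  · exact Or.inl hκ
  right
  -- As κ is large, the gap forces members on the line of y to be near `r`; the corner (x, y') is
  -- only δy away.
  have key : ∀ p : X × Y, p = (p.1, r.2) ∨ p = (r.1, r'.2) → (u' = p ∨ v' = p ∨ w' = p) →
      η * d p r ≤ ε + θ := by
    rintro p (hp | hp) hp'
    · rw [hp] at hp'
      have h₁ := h.gap u' hu₀ v' hv₀ w' hw₀ p.1 hp'
      have h₂ : min κ (η * dist p.1 r.1) ≤ ε + θ := by linarith
      rcases min_le_iff.1 h₂ with h₃ | h₃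
      · linarith
      · rw [hp]
        simpa [d] using h₃
    · rw [hp]
      simp only [d, dist_self, zero_add]
      linarith
  have k₁ := key u' hu₃ (Or.inl rfl)
  have k₂ := key w' hw₃ (Or.inr (Or.inr rfl))
  have tri := mul_le_mul_of_nonneg_left (d_triangle u' r w') hη₀.le
  rw [d_comm r w', mul_add] at tri
  have e₁ : d u' w' ≤ 2 / η * (ε + θ) := by
    rw [div_mul_eq_mul_div, le_div_iff₀ hη₀]
    linarith
  have e₂ := mul_le_mul_of_nonneg_left (pairMin_le η W u' v') (by positivity : 0 ≤ 2 / η)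
  have e₃ := min_le_left (W u' + (1 - η) * d u' w') (W v' + (1 - η) * d v' w')
  have e₄ := hW u' w'
  have e₅ := mul_nonneg hη₀.le (d_nonneg u' w')
  have e₆ : ε + θ ≤ 1 / η * (ε + θ) := by
    have : 0 ≤ ε := le_trans (mul_nonneg hη₀.le dist_nonneg) hy
    refine le_mul_of_one_le_left (by linarith) ?_
    rw [le_div_iff₀ hη₀]
    linarith
  have e₇ : 0 ≤ 1 / η * (ε + θ) := by
    have : 0 ≤ ε := le_trans (mul_nonneg hη₀.le dist_nonneg) hy
    positivity
  have e₈ : 2 / η * (ε + θ) = 2 * (1 / η * (ε + θ)) := by ring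
  have e₉ : 9 / η * (ε + θ) = 9 * (1 / η * (ε + θ)) := by ring
  have e₀ : tripleValue η W u' v' w' = 2 / η * pairValue η W u' v' + W w' -
      min (W u' + (1 - η) * d u' w') (W v' + (1 - η) * d v' w') := rfl
  unfold tripleGain
  linarith

end Step

end GenTwoServer

namespace GenTwoServer

/-! ### The amortized inequality for one request. -/

section Potential

variable {X Y : Type*} [MetricSpace X] [MetricSpace Y]

/-- There is a slack that contributes at most `q` to the potential. -/
def HasSlack (η : ℝ) (W : X × Y → ℝ) (r : X × Y) (q : ℝ) : Prop :=
  ∃ ρ κ θ, Slack η W r ρ κ θ ∧ slackCost η W ρ κ θ ≤ q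

theorem HasSlack.nonneg [Finite X] [Finite Y] [Nonempty X] [Nonempty Y] {η : ℝ} (hη₀ : 0 < η)
    (hη : η < 1 / 2) {W : X × Y → ℝ} {r : X × Y} {q : ℝ} (h : HasSlack η W r q) : 0 ≤ q := by
  obtain ⟨ρ, κ, θ, h, hq⟩ := h
  refine le_trans (add_nonneg (le_min ?_ (le_max_right _ _)) ?_) hq
  · exact mul_nonneg (by positivity) (tripleGain_nonneg (by linarith) W)
  · exact mul_nonneg (slackWeight_nonneg hη₀) h.theta_nonneg

theorem HasSlack.mono {η : ℝ} {W : X × Y → ℝ} {r : X × Y} {q q' : ℝ} (h : HasSlack η W r q)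
    (hq : q ≤ q') : HasSlack η W r q' := by
  obtain ⟨ρ, κ, θ, h, h'⟩ := h
  exact ⟨ρ, κ, θ, h, h'.trans hq⟩

/-- The first term of the minimum in `slackCost` caps the price of discarding κ and θ. -/
theorem Slack.hasSlack_update [Finite X] [Finite Y] {η : ℝ} (hη₀ : 0 < η) (hη : η < 1 / 2)
    {W : X × Y → ℝ} (hW : IsLip W) {r : X × Y} (hr : Generated W r) (r' : X × Y) {ρ κ θ : ℝ}
    (h : Slack η W r ρ κ θ) :
    HasSlack η (GenTwoServer.update W r') r'
      (2 / η * tripleGain η (GenTwoServer.update W r')) := by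
  refine ⟨_, _, _, Slack.reset hη₀ hη hW hr r' h.cover, ?_⟩
  rw [slackCost, mul_zero (slackWeight η), add_zero]
  exact min_le_left _ _

theorem tripleGain_update (η : ℝ) (W : X × Y → ℝ) (r : X × Y) :
    tripleGain η (update W r) = tripleGain η W + 2 / η * (pairMin η (update W r) - pairMin η W) -
      (tripleMin η (update W r) - tripleMin η W) := by
  unfold tripleGain
  ring

theorem HasSlack.update [Finite X] [Finite Y] [Nonempty X] [Nonempty Y] {η : ℝ} (hη₀ : 0 < η)
    (hη : η < 1 / 2) {W : X × Y → ℝ} (hW : IsLip W) {r : X × Y} (hr : Generated W r) (r' : X × Y)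
    {q : ℝ} (h : HasSlack η W r q) :
    HasSlack η (update W r') r'
      (q + 2 / η * (2 / η) * (pairMin η (GenTwoServer.update W r') - pairMin η W) +
        slackWeight η * ((tripleMin η (GenTwoServer.update W r') - tripleMin η W) +
          η * dist r'.1 r.1)) := by
  obtain ⟨ρ, κ, θ, h, hq⟩ := h
  refine ⟨_, _, _, h.update hη₀ hη hW hr r', ?_⟩
  have h₂ := sub_nonneg.2 (pairMin_le_update hη₀ (by linarith : η < 1) hW r')
  have h₃ := sub_nonneg.2 (tripleMin_le_update hη₀ (by linarith : η < 1) hW r')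
  have hi : 0 < 2 / η := by positivity
  have h₄ : 0 ≤ 2 / η * (2 / η) * (pairMin η (GenTwoServer.update W r') - pairMin η W) := by
    positivity
  unfold slackCost at *
  rw [tripleGain_update]
  set e₂ := pairMin η (GenTwoServer.update W r') - pairMin η W
  set e₃ := tripleMin η (GenTwoServer.update W r') - tripleMin η W
  -- The growth 2δy of ρ cancels against 2/η times the growth ηδy of κ.
  have hm : max (max (ρ - 2 * η * dist r'.1 r.1) 0 + 2 * dist r'.2 r.2 -
      2 / η * (κ + η * dist r'.2 r.2)) 0 ≤ max (ρ - 2 / η * κ) 0 := by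
    refine max_le_max ?_ le_rfl
    have : max (ρ - 2 * η * dist r'.1 r.1) 0 ≤ ρ := by
      refine max_le ?_ h.rho_nonneg
      have : 0 ≤ η * dist r'.1 r.1 := mul_nonneg hη₀.le dist_nonneg
      linarith
    have e : 2 / η * (κ + η * dist r'.2 r.2) = 2 / η * κ + 2 * dist r'.2 r.2 := by
      field_simp
    linarith
  have hmin : min (2 / η * (tripleGain η W + 2 / η * e₂ - e₃))
      (max (max (ρ - 2 * η * dist r'.1 r.1) 0 + 2 * dist r'.2 r.2 -
        2 / η * (κ + η * dist r'.2 r.2)) 0) ≤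
      min (2 / η * tripleGain η W) (max (ρ - 2 / η * κ) 0) + 2 / η * (2 / η) * e₂ := by
    rw [← min_add_add_right]
    refine min_le_min ?_ (by linarith)
    have := mul_nonneg hi.le h₃
    linarith
  linarith

theorem step_of_dist_le [Finite X] [Finite Y] [Nonempty X] [Nonempty Y] {η : ℝ} (hη₀ : 0 < η)
    (hη : η < 1 / 2) {W : X × Y → ℝ} (hW : IsLip W) {r : X × Y} (hr : Generated W r) {r' : X × Y}
    (hle : dist r'.2 r.2 ≤ dist r'.1 r.1) {s : X × Y} (hsr : s ∈ request r) {G : ℝ}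
    (hs : ∀ t, W s ≤ W t + (1 - 2 * η) * d s t)
    (hG : ∀ t, G ≤ update W r' t + (1 - 2 * η) * d s t - W s) {q₁ q₂ : ℝ}
    (h₁ : HasSlack η W r q₁) (h₂ : HasSlack η (W ∘ Prod.swap) r.swap q₂) :
    ∃ q₁' q₂', HasSlack η (update W r') r' q₁' ∧
      HasSlack η (update W r' ∘ Prod.swap) r'.swap q₂' ∧
      q₁' + q₂' + η * G ≤ q₁ + q₂ + 10 * slackWeight η *
        ((pairMin η (update W r') - pairMin η W) +
          (tripleMin η (update W r') - tripleMin η W)) := by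
  have he₂ := sub_nonneg.2 (pairMin_le_update hη₀ (by linarith : η < 1) hW r')
  have he₃ := sub_nonneg.2 (tripleMin_le_update hη₀ (by linarith : η < 1) hW r')
  have hgain := tripleGain_update η W r'
  have hinc := mul_increase_le hη₀ hη hW r' hs (by simpa [d_self] using hG s)
  have hinc' : η * G ≤ 2 * (tripleGain η W +
      2 / η * (pairMin η (update W r') - pairMin η W)) := by
    refine hinc.trans (le_of_eq ?_)
    unfold tripleGain
    ring
  have h₂' := h₂.update hη₀ hη hW.swap hr.swap r'.swap
  rw [update_swap, pairMin_swap, pairMin_swap, tripleMin_swap, tripleMin_swap] at h₂'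
  simp only [Prod.fst_swap] at h₂'
  have h₁' := h₁.update hη₀ hη hW hr r'
  have hq₁ := h₁.nonneg hη₀ hη
  have hq₂ := h₂.nonneg hη₀ hη
  have hcov := cover_of_gain hη₀ hη hW hr r'
  obtain ⟨ρ, κ, θ, hS, hq⟩ := h₁
  obtain ⟨ρ₂, κ₂, θ₂, hS₂, -⟩ := h₂
  have hθ := hS.theta_nonneg
  have hsmall := fun h h' => hS.kappa_le_or_gain_le hη₀ hη hW hr r' rfl h h'
  have hcase := tripleGain_nonpos_or_le hη₀ hη hW hr r' hle
  have hδy : 0 ≤ dist r'.2 r.2 := dist_nonneg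
  have hδx : 0 ≤ dist r'.1 r.1 := dist_nonneg
  have hGy : ∀ a, s = (a, r.2) → G ≤ 2 * dist r'.2 r.2 := by
    rintro a rfl
    have h := hG (a, r'.2)
    have := hW (a, r'.2) (a, r.2)
    rw [update_of_mem hW (mem_request_right _ _)] at h
    simp only [d, dist_self, zero_add, dist_comm r.2 r'.2] at h this
    have := mul_nonneg hη₀.le hδy
    linarith
  have hGx : ∀ b, s = (r.1, b) → G ≤ 2 * dist r'.1 r.1 := by
    rintro b rfl
    have h := hG (r'.1, b)
    have := hW (r'.1, b) (r.1, b)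
    rw [update_of_mem hW (mem_request_left _ _)] at h
    simp only [d, dist_self, add_zero, dist_comm r.1 r'.1] at h this
    have := mul_nonneg hη₀.le hδx
    linarith
  have hGle : G ≤ 2 * dist r'.1 r.1 := by
    rcases hsr with h | h
    · exact hGx s.2 (Prod.ext h rfl)
    · exact (hGy s.1 (Prod.ext rfl h)).trans (by linarith)
  -- Test `hG` at (a, y'), with a from the cover property if `s` is on the line of x.
  have hGρ : ∀ ρ' : ℝ, 0 ≤ ρ' →
      (∀ b, ∃ a, W (a, r.2) + (1 - 2 * η) * (dist a r.1 + dist b r.2) ≤ W (r.1, b) + ρ') →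
      G ≤ ρ' + 2 * dist r'.2 r.2 := by
    intro ρ' hρ' hc
    rcases hsr with h | h
    · have hs' : s = (r.1, s.2) := Prod.ext h rfl
      obtain ⟨a, ha⟩ := hc s.2
      have h₁ := hG (a, r'.2)
      have h₂ := hW (a, r'.2) (a, r.2)
      rw [update_of_mem hW (mem_request_right _ _)] at h₁
      rw [hs'] at h₁
      simp only [d, dist_self, zero_add, dist_comm r.1 a] at h₁ h₂
      have h₃ := dist_triangle s.2 r.2 r'.2
      rw [dist_comm r.2 r'.2] at h₃
      have h₄ := mul_le_mul_of_nonneg_left h₃ (by linarith : 0 ≤ 1 - 2 * η)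
      have := mul_nonneg hη₀.le hδy
      linarith
    · have := hGy s.1 (Prod.ext rfl h)
      linarith
  have hK₀ : 0 ≤ tripleGain η W := tripleGain_nonneg (by linarith) W
  have hR : 2 / η * pairMin η (update W r') - tripleMin η W =
      tripleGain η W + 2 / η * (pairMin η (update W r') - pairMin η W) := by
    unfold tripleGain
    ring
  rw [hR] at hcov
  have hB := slackWeight_nonneg hη₀
  have hBi : slackWeight η = (2 / η + 2) * (9 / η) := rfl
  unfold slackCost at hq
  set e₂ := pairMin η (update W r') - pairMin η W 
  set e₃ := tripleMin η (update W r') - tripleMin η W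
  set K := tripleGain η W
  set B := slackWeight η
  set δx := dist r'.1 r.1
  set δy := dist r'.2 r.2
  -- Everything is rewritten in i = 1/η ≥ 2, so that products with i and i² become atoms of linear
  -- arithmetic.
  have cη : ∀ c : ℝ, c / η = c * η⁻¹ := fun c => div_eq_mul_inv c η
  have hiη : η⁻¹ * η = 1 := inv_mul_cancel₀ hη₀.ne'
  have hi : 2 ≤ η⁻¹ := by
    rw [le_inv_comm₀ two_pos hη₀]
    linarith
  rw [cη] at hq hinc' hgain
  rw [cη, cη] at hBi
  simp only [cη] at h₁' h₂' hcov hsmall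
  set i := η⁻¹
  have hii : 2 * i ≤ i * i := mul_le_mul_of_nonneg_right hi (by linarith)
  have hBe : ∀ e : ℝ, 0 ≤ e → 0 ≤ i * e ∧ 2 * e ≤ i * e ∧ 2 * (i * e) ≤ i * i * e ∧
      B * e = 18 * (i * i * e) + 18 * (i * e) := by
    intro e he
    refine ⟨mul_nonneg (by linarith) he, mul_le_mul_of_nonneg_right hi he, ?_, ?_⟩
    · have := mul_le_mul_of_nonneg_right hii he
      linarith
    · rw [hBi]
      ring
  obtain ⟨a₂, b₂, c₂, d₂⟩ := hBe e₂ he₂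
  obtain ⟨a₃, b₃, c₃, d₃⟩ := hBe e₃ he₃
  obtain ⟨aθ, bθ, cθ, dθ⟩ := hBe θ hθ
  have hmin₀ : 0 ≤ min (2 * i * K) (max (ρ - 2 * i * κ) 0) :=
    le_min (mul_nonneg (by linarith) hK₀) (le_max_right _ _)
  rcases hcase with hK' | hy
  · have hK'' : 2 / η * tripleGain η (update W r') ≤ 0 :=
      mul_nonpos_of_nonneg_of_nonpos (by positivity) hK'
    have h := hS₂.hasSlack_update hη₀ hη hW.swap hr.swap r'.swap
    rw [update_swap, tripleGain_swap] at h
    exact ⟨0, 0, (hS.hasSlack_update hη₀ hη hW hr r').mono hK'', h.mono hK'', by linarith⟩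
  · have hBy : B * (η * δy) ≤ B * e₃ := mul_le_mul_of_nonneg_left hy hB
    have hδi : δy ≤ i * e₃ := by
      have := mul_le_mul_of_nonneg_left hy (by linarith : 0 ≤ i)
      rwa [← mul_assoc, hiη, one_mul] at this
    have hηG := mul_le_mul_of_nonneg_left hGle hη₀.le
    rcases le_or_gt (η * δx) (e₂ + e₃) with hx | hx
    · have hBx : B * (η * δx) ≤ B * (e₂ + e₃) := mul_le_mul_of_nonneg_left hx hB
      exact ⟨_, _, h₁', h₂', by linarith⟩
    · rcases hsmall hy (by linarith) with hκ | hK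
      · have hR₀ : 0 ≤ 2 * i * (K + 2 * i * e₂) + 2 * δy := by positivity
        rw [max_eq_left hR₀] at hcov
        -- Both numbers are valid cover bounds; their minimum is dominated, up to paid terms, by
        -- both terms in the old `slackCost`.
        set ρ₁ := min ρ (2 * i * (K + 2 * i * e₂) + 2 * δy)
        have hρ₁ : 0 ≤ ρ₁ := le_min hS.rho_nonneg hR₀
        have hc : ∀ b, ∃ a, W (a, r.2) + (1 - 2 * η) * (dist a r.1 + dist b r.2) ≤
            W (r.1, b) + ρ₁ := by
          rcases min_choice ρ (2 * i * (K + 2 * i * e₂) + 2 * δy) with e | e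
          · rw [show ρ₁ = ρ from e]
            exact hS.cover
          · rw [show ρ₁ = _ from e]
            exact hcov (by linarith)
        have hGρ₁ := hGρ ρ₁ hρ₁ hc
        refine ⟨max (ρ₁ - 2 * η * δx) 0 + 2 * δy, _,
          ⟨_, _, _, Slack.reset hη₀ hη hW hr r' hc, ?_⟩, h₂', ?_⟩
        · have : 0 ≤ max (ρ₁ - 2 * η * δx) 0 + 2 * δy := add_nonneg (le_max_right _ _) (by linarith)
          unfold slackCost
          rw [mul_zero, mul_zero, sub_zero, add_zero, max_eq_left this]
          exact min_le_right _ _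
        · have hκi := mul_le_mul_of_nonneg_left hκ (by linarith : 0 ≤ 2 * i)
          have k₁ : ρ₁ - 4 * (i * i * e₂) - 2 * δy - 2 * (i * e₃) - 2 * (i * θ) ≤
              min (2 * i * K) (max (ρ - 2 * i * κ) 0) := by
            refine le_min ?_ (le_max_of_le_left ?_)
            · have : ρ₁ ≤ 2 * i * (K + 2 * i * e₂) + 2 * δy := min_le_right _ _
              linarith
            · have : ρ₁ ≤ ρ := min_le_left _ _
              have : 0 ≤ i * i * e₂ := by linarith
              linarith
          have k₂ : max (ρ₁ - 2 * η * δx) 0 + η * G ≤ ρ₁ + 2 * δy := by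
            rcases max_choice (ρ₁ - 2 * η * δx) 0 with e | e <;> rw [e]
            · linarith
            · have e₁ := mul_le_mul_of_nonneg_left hGρ₁ hη₀.le
              have e₂ := mul_le_of_le_one_left (by linarith : 0 ≤ ρ₁ + 2 * δy)
                (by linarith : η ≤ 1)
              linarith
          linarith
      -- The reset costs 2iK and `G` costs 2K up to paid terms; `slackWeight` is chosen so that the
      -- released θ and the rise `e₃` pay for (2i + 2)K.
      · refine ⟨_, _, hS.hasSlack_update hη₀ hη hW hr r', h₂', ?_⟩
        rw [hgain, cη]
        have k₁ := mul_le_mul_of_nonneg_left hK (by linarith : 0 ≤ 2 * i + 2)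
        have k₂ : (2 * i + 2) * (9 * i * (e₃ + θ)) = B * e₃ + B * θ := by
          rw [hBi]
          ring
        linarith

/-- One request: the contributions of the slacks and the cost of the algorithm are covered by the
increase of the potentials. -/
theorem step [Finite X] [Finite Y] [Nonempty X] [Nonempty Y] {η : ℝ} (hη₀ : 0 < η)
    (hη : η < 1 / 2) {W : X × Y → ℝ} (hW : IsLip W) {r : X × Y} (hr : Generated W r) (r' : X × Y)
    {s : X × Y} (hsr : s ∈ request r) {G : ℝ}
    (hs : ∀ t, W s ≤ W t + (1 - 2 * η) * d s t)
    (hG : ∀ t, G ≤ update W r' t + (1 - 2 * η) * d s t - W s) {q₁ q₂ : ℝ}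
    (h₁ : HasSlack η W r q₁) (h₂ : HasSlack η (W ∘ Prod.swap) r.swap q₂) :
    ∃ q₁' q₂', HasSlack η (update W r') r' q₁' ∧
      HasSlack η (update W r' ∘ Prod.swap) r'.swap q₂' ∧
      q₁' + q₂' + η * G ≤ q₁ + q₂ + 10 * slackWeight η *
        ((pairMin η (update W r') - pairMin η W) +
          (tripleMin η (update W r') - tripleMin η W)) := by
  rcases le_total (dist r'.2 r.2) (dist r'.1 r.1) with h | h
  · exact step_of_dist_le hη₀ hη hW hr h hsr hs hG h₁ h₂
  · have hs' : ∀ t, (W ∘ Prod.swap) s.swap ≤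
        (W ∘ Prod.swap) t + (1 - 2 * η) * d s.swap t := by
      intro t
      have := hs t.swap
      rwa [← d_swap, Prod.swap_swap] at this
    have hG' : ∀ t, G ≤ update (W ∘ Prod.swap) r'.swap t + (1 - 2 * η) * d s.swap t -
        (W ∘ Prod.swap) s.swap := by
      intro t
      have := hG t.swap
      rw [← d_swap, Prod.swap_swap] at this
      rwa [update_swap]
    obtain ⟨q₁', q₂', k₁, k₂, k₃⟩ := step_of_dist_le (r' := r'.swap) (s := s.swap) hη₀ hη hW.swap
      hr.swap h hsr.symm hs' hG' h₂ h₁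
    rw [update_swap] at k₁ k₂ k₃
    simp only [pairMin_swap, tripleMin_swap] at k₃
    exact ⟨q₂', q₁', k₂, k₁, by linarith⟩

end Potential

end GenTwoServer

namespace GenTwoServer

/-! ### Summation over a request sequence in finite spaces. -/

section Sequence

variable {X Y : Type*} [MetricSpace X] [MetricSpace Y]

/-- Continuing from s' to its parent would save 2η times their distance, so they coincide. -/
theorem mem_request_of_isMinOn {η : ℝ} (hη₀ : 0 < η) (hη : η < 1 / 2) {W : X × Y → ℝ}
    {r s s' : X × Y}
    (hr : Generated W r)
    (h : ∀ t, W s' + (1 - 2 * η) * d s s' ≤ W t + (1 - 2 * η) * d s t) : s' ∈ request r := by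
  obtain ⟨p, hp, e⟩ := hr.exists_eq_add s'
  have h₁ := h p
  have h₂ := mul_le_mul_of_nonneg_left (d_triangle s s' p) (by linarith : 0 ≤ 1 - 2 * η)
  have h₃ : d s' p ≤ 0 := by
    by_contra hlt
    have := mul_pos hη₀ (not_le.1 hlt)
    linarith
  rwa [eq_of_d_le_zero h₃]

theorem potential_d_nonneg [Finite X] [Finite Y] [Nonempty X] [Nonempty Y] {η : ℝ} (hη₀ : 0 < η)
    (hη : η < 1 / 2) (o : X × Y) : 0 ≤ pairMin η (d o) + tripleMin η (d o) := by
  have key : ∀ u v : X × Y, η * (d o u + d o v) ≤ pairValue η (d o) u v := by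
    intro u v
    have h₁ := d_triangle u o v
    rw [d_comm u o] at h₁
    have h₂ := mul_le_mul_of_nonneg_left h₁ (by linarith : 0 ≤ 1 - η)
    unfold pairValue
    linarith
  refine add_nonneg ?_ ?_
  · refine le_ciInf fun p => le_trans ?_ (key _ _)
    exact mul_nonneg hη₀.le (add_nonneg (d_nonneg _ _) (d_nonneg _ _))
  · refine le_ciInf fun ⟨u, v, w⟩ => ?_
    have h₁ := mul_le_mul_of_nonneg_left (key u v) (by positivity : 0 ≤ 2 / η)
    have h₂ : 2 / η * (η * (d o u + d o v)) = 2 * (d o u + d o v) := by field_simp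
    have h₃ := min_le_left (d o u + (1 - η) * d u w) (d o v + (1 - η) * d v w)
    have h₄ := d_triangle u o w
    rw [d_comm u o] at h₄
    have h₅ := mul_le_mul_of_nonneg_left h₄ (by linarith : 0 ≤ 1 - η)
    have h₆ := mul_nonneg hη₀.le (d_nonneg o u)
    have h₇ := mul_nonneg hη₀.le (d_nonneg o w)
    have h₈ := d_nonneg o v
    simp only [tripleValue]
    linarith

theorem hasSlack_d [Finite X] [Finite Y] [Nonempty X] [Nonempty Y] {η : ℝ} (hη₀ : 0 < η)
    (o : X × Y) : HasSlack η (d o) o 0 := by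
  refine ⟨0, 0, 0, ⟨le_rfl, le_rfl, le_rfl, fun b => ⟨o.1, ?_⟩, fun u _ v _ w _ a _ => ?_⟩, ?_⟩
  · have := mul_nonneg hη₀.le (dist_nonneg (x := b) (y := o.2))
    simp only [d, dist_self, dist_comm o.2 b]
    linarith
  · have := tripleMin_le η (d o) u v w
    have := min_le_left 0 (η * dist a o.1)
    linarith
  · simp [slackCost]

/-- The total cost of a sequence of moves of the generalized work function algorithm in finite
metric spaces. -/
theorem sum_d_le_of_finite [Finite X] [Finite Y] [Nonempty X] [Nonempty Y] {η : ℝ} (hη₀ : 0 < η)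
    (hη : η < 1 / 2) {N : ℕ} {W : ℕ → X × Y → ℝ} {r s : ℕ → X × Y} (hW₀ : W 0 = d (r 0))
    (hs₀ : s 0 = r 0) (hW : ∀ n < N, W (n + 1) = update (W n) (r (n + 1)))
    (hs : ∀ n < N, ∀ t, W (n + 1) (s (n + 1)) + (1 - 2 * η) * d (s n) (s (n + 1)) ≤
      W (n + 1) t + (1 - 2 * η) * d (s n) t) (p : X × Y) :
    η * (1 - 2 * η) * ∑ i ∈ Finset.range N, d (s i) (s (i + 1)) ≤
      10 * slackWeight η * (2 + 4 / η) * W N p := by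
  have hl : 0 ≤ 1 - 2 * η := by linarith
  -- In the last clause the charges have telescoped, starting from W₀(s₀) = 0.
  have inv : ∀ n ≤ N, IsLip (W n) ∧ Generated (W n) (r n) ∧ (∀ t, 0 ≤ W n t) ∧
      s n ∈ request (r n) ∧ (∀ t, W n (s n) ≤ W n t + (1 - 2 * η) * d (s n) t) ∧
      ∃ q₁ q₂, HasSlack η (W n) (r n) q₁ ∧ HasSlack η (W n ∘ Prod.swap) (r n).swap q₂ ∧
        η * ((1 - 2 * η) * ∑ i ∈ Finset.range n, d (s i) (s (i + 1)) + W n (s n)) + q₁ + q₂ ≤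
          10 * slackWeight η * (pairMin η (W n) + tripleMin η (W n)) := by
    intro n
    induction n with
    | zero =>
      intro _
      rw [hW₀, hs₀]
      refine ⟨isLip_d _, generated_d _, fun t => d_nonneg _ _, Or.inl rfl, fun t => ?_, 0, 0,
        hasSlack_d hη₀ _, ?_, ?_⟩
      · rw [d_self]
        exact add_nonneg (d_nonneg _ _) (mul_nonneg hl (d_nonneg _ _))
      · have h := hasSlack_d hη₀ (r 0).swap
        have e : d (r 0).swap = d (r 0) ∘ Prod.swap := by
          funext t
          rw [Function.comp_apply, ← d_swap, Prod.swap_swap]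
        rwa [e] at h
      · rw [d_self]
        simpa using mul_nonneg (mul_nonneg (by norm_num) (slackWeight_nonneg hη₀))
          (potential_d_nonneg hη₀ hη (r 0))
    | succ n ih =>
      intro hn
      obtain ⟨hLip, hGen, hpos, hmem, hgood, q₁, q₂, h₁, h₂, hq⟩ := ih (by omega)
      have hmove := hs n hn
      have hWn := hW n hn
      have hGen' : Generated (W (n + 1)) (r (n + 1)) := by
        rw [hWn]
        exact generated_update hLip _
      obtain ⟨q₁', q₂', h₁', h₂', hq'⟩ := step hη₀ hη hLip hGen (r (n + 1)) hmem
        (G := W (n + 1) (s (n + 1)) + (1 - 2 * η) * d (s n) (s (n + 1)) - W n (s n)) hgood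
        (fun t => by
          rw [← hWn]
          linarith [hmove t]) h₁ h₂
      rw [← hWn] at h₁' h₂' hq'
      refine ⟨?_, hGen', fun t => ?_, mem_request_of_isMinOn hη₀ hη hGen' hmove, fun t => ?_,
        q₁', q₂', h₁', h₂', ?_⟩
      · rw [hWn]
        exact hLip.update _
      · rw [hWn]
        exact (hpos t).trans (le_update hLip _ _)
      · have := hmove t
        have := mul_le_mul_of_nonneg_left (d_triangle (s n) (s (n + 1)) t) hl
        linarith
      · rw [Finset.sum_range_succ]
        linarith
  obtain ⟨-, -, hpos, -, -, q₁, q₂, h₁, h₂, hq⟩ := inv N le_rfl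
  have := h₁.nonneg hη₀ hη
  have := h₂.nonneg hη₀ hη
  have := mul_nonneg hη₀.le (hpos (s N))
  -- The constant pair and triple at `p` have values 2W(p) and (4/η)W(p).
  have hp₂ := pairMin_le η (W N) p p
  have hp₃ := tripleMin_le η (W N) p p p
  simp only [tripleValue, pairValue, d_self, mul_zero, sub_zero, add_zero, min_self] at hp₂ hp₃
  have hle : pairMin η (W N) + tripleMin η (W N) ≤ (2 + 4 / η) * W N p := by
    have : (2 + 4 / η) * W N p = 2 * W N p + 2 / η * (W N p + W N p) := by ring
    linarith
  have := mul_le_mul_of_nonneg_left hle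
    (mul_nonneg (by norm_num) (slackWeight_nonneg hη₀) : 0 ≤ 10 * slackWeight η)
  linarith

end Sequence

end GenTwoServer

namespace GenTwoServer

/-! ### Work functions as infima over paths, existence of moves, and reduction to finite spaces. -/

section Work

variable {X Y : Type*}

theorem serves_self (σ : List (X × Y)) : Serves σ σ :=
  List.forall₂_same.2 fun _ _ => Or.inl rfl

theorem serves_append_singleton {p σ : List (X × Y)} {r : X × Y} :
    Serves p (σ ++ [r]) ↔ ∃ q t, p = q ++ [t] ∧ Serves q σ ∧ t ∈ request r := by
  constructor
  · intro h
    have h₁ := List.forall₂_take_append p σ [r] h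
    have h₂ := List.forall₂_drop_append p σ [r] h
    obtain ⟨t, l, ht, hl, e⟩ := List.forall₂_cons_right_iff.1 h₂
    rw [List.forall₂_nil_right_iff.1 hl] at e
    exact ⟨_, t, by rw [← e, List.take_append_drop], h₁, ht⟩
  · rintro ⟨q, t, rfl, hq, ht⟩
    exact List.rel_append hq (List.Forall₂.cons ht List.Forall₂.nil)

variable [MetricSpace X] [MetricSpace Y]

theorem pathLength_nonneg (o : X × Y) (p : List (X × Y)) : 0 ≤ pathLength o p := by
  induction p generalizing o with
  | nil => exact le_rfl
  | cons s p ih => exact add_nonneg (d_nonneg _ _) (ih s)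

theorem pathLength_concat (o : X × Y) (p : List (X × Y)) (s : X × Y) :
    pathLength o (p ++ [s]) = pathLength o p + d (p.getLastD o) s := by
  induction p generalizing o with
  | nil => simp [pathLength]
  | cons t p ih =>
    rw [List.cons_append, pathLength, ih, List.getLastD_cons, pathLength]
    ring

theorem bddBelow_pathLength (o : X × Y) (σ : List (X × Y)) (f : List (X × Y) → List (X × Y)) :
    BddBelow {L | ∃ p, Serves p σ ∧ L = pathLength o (f p)} := by
  refine ⟨0, ?_⟩
  rintro L ⟨p, -, rfl⟩
  exact pathLength_nonneg _ _

theorem work_le {o : X × Y} {σ p : List (X × Y)} (hp : Serves p σ) (s : X × Y) :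
    work o σ s ≤ pathLength o (p ++ [s]) :=
  csInf_le (bddBelow_pathLength o σ fun p => p ++ [s]) ⟨p, hp, rfl⟩

theorem le_work {o : X × Y} {σ : List (X × Y)} {s : X × Y} {c : ℝ}
    (h : ∀ p, Serves p σ → c ≤ pathLength o (p ++ [s])) : c ≤ work o σ s := by
  refine le_csInf ⟨_, σ, serves_self σ, rfl⟩ ?_
  rintro L ⟨p, hp, rfl⟩
  exact h p hp

theorem isLip_work (o : X × Y) (σ : List (X × Y)) : IsLip (work o σ) := by
  intro s t
  rw [← sub_le_iff_le_add]
  refine le_work fun p hp => ?_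
  have h₁ := work_le (o := o) hp s
  rw [pathLength_concat] at h₁ ⊢
  have h₂ := d_triangle (p.getLastD o) t s
  rw [d_comm t s] at h₂
  linarith

theorem work_nil (o : X × Y) : work o [] = d o := by
  funext s
  refine le_antisymm ?_ (le_work fun p hp => ?_)
  · simpa [pathLength] using work_le (o := o) (serves_self []) s
  · rw [List.forall₂_nil_right_iff.1 hp]
    simp [pathLength]

theorem work_append (o : X × Y) (σ : List (X × Y)) (r : X × Y) :
    work o (σ ++ [r]) = update (work o σ) r := by
  funext s
  refine le_antisymm ?_ (le_work fun p hp => ?_)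
  · obtain ⟨t, ht, e⟩ := update_eq_add (work o σ) r s
    rw [e, ← sub_le_iff_le_add]
    refine le_work fun p hp => ?_
    have h := work_le (o := o) (serves_append_singleton.2 ⟨p, t, rfl, hp, ht⟩) s
    rw [pathLength_concat _ (p ++ [t]), List.getLastD_concat, d_comm t s] at h
    linarith
  · obtain ⟨q, t, rfl, hq, ht⟩ := serves_append_singleton.1 hp
    rw [pathLength_concat _ (q ++ [t]), List.getLastD_concat, d_comm t s]
    have h₁ := update_le_add (isLip_work o σ) ht s
    have h₂ := work_le (o := o) hq t
    linarith

theorem le_opt {o : X × Y} {σ : List (X × Y)} {c : ℝ} (h : ∀ s, c ≤ work o σ s) :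
    c ≤ opt o σ := by
  refine le_csInf ⟨_, σ, serves_self σ, rfl⟩ ?_
  rintro L ⟨p, hp, rfl⟩
  have h₁ := (h (p.getLastD o)).trans (work_le hp _)
  rwa [pathLength_concat, d_self, add_zero] at h₁

/-- A work function is determined by its values at finitely many configurations. -/
theorem exists_finite_support (o : X × Y) (σ : List (X × Y)) :
    ∃ P : Set (X × Y), P.Finite ∧ P.Nonempty ∧ ∀ s, ∃ p ∈ P, work o σ p + d s p ≤ work o σ s := by
  induction σ using List.reverseRecOn with
  | nil =>
    refine ⟨{o}, Set.finite_singleton o, Set.singleton_nonempty o, fun s => ⟨o, rfl, ?_⟩⟩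
    rw [work_nil, d_self, zero_add, d_comm]
  | append_singleton σ r ih =>
    obtain ⟨P, hP, ⟨p₀, hp₀⟩, h⟩ := ih
    refine ⟨(fun p => (r.1, p.2)) '' P ∪ (fun p => (p.1, r.2)) '' P,
      (hP.image _).union (hP.image _), ⟨_, Or.inl ⟨p₀, hp₀, rfl⟩⟩, fun s => ?_⟩
    have hL := isLip_work o σ
    rw [work_append]
    rcases min_choice (work o σ (r.1, s.2) + dist s.1 r.1) (work o σ (s.1, r.2) + dist s.2 r.2)
      with e | e
    · obtain ⟨p, hp, hps⟩ := h (r.1, s.2)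
      refine ⟨_, Or.inl ⟨p, hp, rfl⟩, ?_⟩
      have h₁ := hL (r.1, p.2) p
      rw [update_of_mem hL (mem_request_left r p.2), update, e]
      simp only [d, dist_self, add_zero] at h₁ hps ⊢
      linarith
    · obtain ⟨p, hp, hps⟩ := h (s.1, r.2)
      refine ⟨_, Or.inr ⟨p, hp, rfl⟩, ?_⟩
      have h₁ := hL (p.1, r.2) p
      rw [update_of_mem hL (mem_request_right r p.1), update, e]
      simp only [d, dist_self, zero_add] at h₁ hps ⊢
      linarith

/-- As λ ≤ 1, passing from t to a supporting configuration does not increase the objective, so a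
finite minimum suffices. -/
theorem exists_isWFAMove {lam : ℝ} (h₀ : 0 ≤ lam) (h₁ : lam ≤ 1) (o : X × Y) (σ : List (X × Y))
    (r s : X × Y) : ∃ s', IsWFAMove lam o σ r s s' := by
  obtain ⟨P, hP, hne, h⟩ := exists_finite_support o (σ ++ [r])
  obtain ⟨s', -, hs'⟩ := Set.exists_min_image P (fun t => work o (σ ++ [r]) t + lam * d s t) hP hne
  refine ⟨s', fun t => ?_⟩
  obtain ⟨p, hp, hpt⟩ := h t
  have h₂ := hs' p hp
  have h₃ := mul_le_mul_of_nonneg_left (d_triangle s t p) h₀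
  have h₄ := mul_le_of_le_one_left (d_nonneg t p) h₁
  linarith

theorem IsWFA.isOnlineAlgorithm {η : ℝ} (hη₀ : 0 < η) (hη : η < 1 / 2) {o : X × Y}
    {A : List (X × Y) → X × Y} (hA : IsWFA (1 - 2 * η) o A) : IsOnlineAlgorithm o A := by
  refine ⟨hA.1, fun σ r => mem_request_of_isMinOn hη₀ hη ?_ (hA.2 σ r)⟩
  rw [work_append]
  exact generated_update (isLip_work o σ) r

theorem IsWFA.mul_cost_le_work {η : ℝ} (hη₀ : 0 < η) (hη : η < 1 / 2) {o : X × Y}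
    {A : List (X × Y) → X × Y} (hA : IsWFA (1 - 2 * η) o A) (σ : List (X × Y)) (p : X × Y) :
    η * (1 - 2 * η) * cost A σ ≤ 10 * slackWeight η * (2 + 4 / η) * work o σ p := by
  set N := σ.length with hN
  -- The origin acts as request 0, since `d o` is generated by `o`; the default `o` keeps the range
  -- finite.
  let r : ℕ → X × Y := fun i => (o :: σ).getD i o
  let s : ℕ → X × Y := fun i => A (σ.take i)
  have hfin : (Set.range r ∪ Set.range s ∪ {p}).Finite := by
    refine Set.Finite.union (Set.Finite.union ?_ ?_) (Set.finite_singleton p)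
    · refine ((Set.finite_Iic N).image r).subset ?_
      rintro _ ⟨i, rfl⟩
      rcases le_or_gt i N with h | h
      · exact ⟨i, h, rfl⟩
      · refine ⟨0, Nat.zero_le _, ?_⟩
        exact (List.getD_eq_default (o :: σ) o (n := i) h).symm
    · refine ((Set.finite_Iic N).image s).subset ?_
      rintro _ ⟨i, rfl⟩
      rcases le_or_gt i N with h | h
      · exact ⟨i, h, rfl⟩
      · refine ⟨N, Set.mem_Iic.2 le_rfl, ?_⟩
        simp only [s]
        rw [hN, List.take_length, List.take_of_length_le h.le]
  set S := Set.range r ∪ Set.range s ∪ {p}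
  have hr : ∀ i, r i ∈ S := fun i => Or.inl (Or.inl ⟨i, rfl⟩)
  have hs : ∀ i, s i ∈ S := fun i => Or.inl (Or.inr ⟨i, rfl⟩)
  have hp : p ∈ S := Or.inr rfl
  -- An update only recombines coordinates of configurations and requests, so it commutes with
  -- restriction to this grid, and the moves remain minimizers there.
  let lift : ∀ q ∈ S, (Prod.fst '' S) × (Prod.snd '' S) :=
    fun q hq => (⟨q.1, q, hq, rfl⟩, ⟨q.2, q, hq, rfl⟩)
  have : Finite (Prod.fst '' S) := (hfin.image _).to_subtype
  have : Finite (Prod.snd '' S) := (hfin.image _).to_subtype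
  have : Nonempty (Prod.fst '' S) := ⟨(lift p hp).1⟩
  have : Nonempty (Prod.snd '' S) := ⟨(lift p hp).2⟩
  have htake : ∀ n, n < N → σ.take (n + 1) = σ.take n ++ [r (n + 1)] := by
    intro n hn
    simp only [r]
    rw [List.getD_cons_succ, List.getD_eq_getElem _ _ hn, List.take_append_getElem hn]
  have main := sum_d_le_of_finite (N := N) hη₀ hη
    (W := fun n q => work o (σ.take n) (q.1.1, q.2.1)) (r := fun i => lift (r i) (hr i))
    (s := fun i => lift (s i) (hs i)) ?_ ?_ ?_ ?_ (lift p hp)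
  · simp only [hN, List.take_length] at main
    exact main
  · funext q
    rw [List.take_zero, work_nil]
    rfl
  · have h : s 0 = r 0 := hA.1
    simp only [h]
  · intro n hn
    funext q
    rw [htake n hn, work_append]
    rfl
  · intro n hn t
    have h := hA.2 (σ.take n) (r (n + 1)) (t.1.1, t.2.1)
    rw [← htake n hn] at h
    exact h

end Work

end GenTwoServer

theorem theorem2 (lam : ℝ) (hlam0 : 0 < lam) (hlam1 : lam < 1) :
    ∃ c : ℝ, 1 ≤ c ∧ ∃ c₀ : ℝ,
      ∀ (X Y : Type*) [MetricSpace X] [MetricSpace Y] (o : X × Y),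
        (∀ (σ : List (X × Y)) (r s : X × Y), ∃ s', GenTwoServer.IsWFAMove lam o σ r s s') ∧
        ∀ A : List (X × Y) → X × Y, GenTwoServer.IsWFA lam o A →
          GenTwoServer.IsOnlineAlgorithm o A ∧
          ∀ σ : List (X × Y),
            GenTwoServer.cost A σ ≤ c * GenTwoServer.opt o σ + c₀ := by
  obtain ⟨η, rfl⟩ : ∃ η, lam = 1 - 2 * η := ⟨(1 - lam) / 2, by ring⟩
  have hη₀ : 0 < η := by linarith
  have hη : η < 1 / 2 := by linarith
  have hk : 0 < η * (1 - 2 * η) := mul_pos hη₀ hlam0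
  set C := 10 * GenTwoServer.slackWeight η * (2 + 4 / η) / (η * (1 - 2 * η)) with hC
  refine ⟨max C 1, le_max_right _ _, 0, fun X Y _ _ o =>
    ⟨fun σ r s => GenTwoServer.exists_isWFAMove hlam0.le hlam1.le o σ r s, fun A hA =>
      ⟨hA.isOnlineAlgorithm hη₀ hη, fun σ => ?_⟩⟩⟩
  have hopt : 0 ≤ GenTwoServer.opt o σ :=
    GenTwoServer.le_opt fun s => GenTwoServer.le_work fun p _ => GenTwoServer.pathLength_nonneg _ _
  have hcost : GenTwoServer.cost A σ ≤ C * GenTwoServer.opt o σ := by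
    have hC₀ : 0 < C := by
      rw [hC]
      unfold GenTwoServer.slackWeight
      positivity
    rw [← div_le_iff₀' hC₀]
    refine GenTwoServer.le_opt fun s => ?_
    rw [div_le_iff₀' hC₀, hC, div_mul_eq_mul_div, le_div_iff₀' hk]
    exact hA.mul_cost_le_work hη₀ hη σ s
  have := mul_le_mul_of_nonneg_right (le_max_left C 1) hopt
  linarith
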